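/- **Setting.** A \emph{directed acyclic multigraph} (DAMG) $G=(V,E)$ has a finite vertex set $V$, a finite set $E$ of (possibly parallel) directed edges $e$, each with a tail and a head in $V$, and admits a topological ordering, i.e. a total order of $V$ that strictly increases along every edge. $E(x,y)$ is the set of edges $x\to y$; $\mathrm{Pa}^G(y)$ is the set of parents of $y$; $\mathrm{Rt}(G)$ is the set of roots (vertices without parents); $\Pi^G(x,y)$ is the set of directed paths from $x$ to $y$ (including the trivial path if $x=y$) and $\pi^G(x,y)$ its cardinality; $\mathrm{Anc}^G(x)$ and $\mathrm{Desc}^G(x)$ are the sets of ancestors and descendants of $x$, both including $x$. Let $R$ be a commutative ring with one, $A$ an $R$-module, $q:E\to R$ an edge weight function, and $q(x|y):=\sum_{e\in E(x,y)}q(e)$. Call $q$ \emph{normalized} if $\sum_{x\in V}q(x|y)=1$ for every $y\in V\setminus\mathrm{Rt}(G)$. The \emph{total path weights} are defined recursively by $s(x|y)=0$ if $y\notin\mathrm{Desc}^G(x)$, $s(x|x)=1$, and $s(x|y)=\sum_{z\in\mathrm{Pa}^G(y)}s(x|z)\,q(z|y)$ otherwise. For $\varsigma:E\to R$ and $\tau:\mathrm{Rt}(G)\to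 R$, the \emph{element weights} $\tau:V\to R$ extend $\tau$ by $\tau(y)=\sum_{z\in\mathrm{Pa}^G(y)}\tau(z)\,\varsigma(z,y)$ for $y\notin\mathrm{Rt}(G)$, where $\varsigma(z,y):=\sum_{e\in E(z,y)}\varsigma(e)$. The \emph{synergy function} of $v:V\to A$ with respect to $G$ is defined recursively by $v'_G(x)=v(x)-\sum_{y\in\mathrm{Anc}^G(x)\setminus\{x\}}v'_G(y)$. A vertex $z$ is \emph{weak} for $(G,v)$ if $v'_G(z)=0$, and \emph{null} if $v'_G(x)=0$ for all $x\in\mathrm{Desc}^G(z)$. **Projection.** For $z\in V$, the projection $G^{\setminus z}$ has vertex set $V\setminus\{z\}$; its edges are the edges of $G$ that avoid $z$, with weight $q^{\setminus z}(e)=q(e)$, and one composite edge $x\xrightarrow{e_1e_2}y$ for every pair of edges $x\xrightarrow{e_1}z\xrightarrow{e_2}y$ of $G$, with weight $q^{\setminus z}(e_1e_2)=q(e_1)q(e_2)$. For $w=v'_G$ put $w^{\setminus z}(x)=w(x)+q(x|z)\,w(z)$. For $S\subseteq V$, the projections $G^{\setminus S},q^{\setminus S},w^{\setminus S}$ are obtained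 by projecting out the elements of $S$ one after the other, and $v^{\setminus S}(y):=\sum_{x\in\mathrm{Anc}^{G^{\setminus S}}(y)}w^{\setminus S}(x)$. Every edge of a projection thus stands for a word of edges of $G$; graphs obtained from $G$ by projections are regarded as equal, together with their weights, if they have the same vertices and there is a bijection of their edges that preserves tails, heads, words and weights. Put $V^{\setminus S}:=V\setminus S$, and let $s^{\setminus S}$ be the total path weights of $(G^{\setminus S},q^{\setminus S})$. For $\varsigma,\tau$ as above, $\varsigma^{\setminus S}$ is defined from $\varsigma$ as $q^{\setminus S}$ is from $q$, and $\tau^{\setminus S}:V^{\setminus S}\to R$ is the extension, on $(G^{\setminus S},\varsigma^{\setminus S})$, of the restriction $\tau|_{\mathrm{Rt}(G^{\setminus S})}$ of the element weights of $G$. A subset $S\subseteq V$ is \emph{admissible} for $G$ if, with $T:=S\setminus\mathrm{Rt}(G)$ and $U:=S\cap\mathrm{Rt}(G)$, for every vertex $y$ of $G^{\setminus T}$: if $\mathrm{Pa}^{G^{\setminus T}}(y)\cap U\neq\emptyset$ then $\mathrm{Pa}^{G^{\setminus T}}(y)\subseteq U$. **Theorem (Properties of the projection operators).** Let $G=(V,E)$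 be a DAMG, $q:E\to R$ a weight function, $v:V\to A$ a value function with synergy function $w=v'_G$, and $S\subseteq V$ any subset. Then $G^{\setminus S}$, $q^{\setminus S}$ and $w^{\setminus S}$ do not depend on the order in which the elements of $S$ are projected out, and: 1. *DAMG*: $G^{\setminus S}$ is a DAMG, with vertex set $V\setminus S$. 2. *Roots*: $\mathrm{Rt}(G)\setminus S\subseteq\mathrm{Rt}(G^{\setminus S})$, with equality if $S\cap\mathrm{Rt}(G)=\emptyset$. 3. *Ancestors*: $\mathrm{Anc}^{G^{\setminus S}}(y)=\mathrm{Anc}^G(y)\setminus S$ for every $y\in V^{\setminus S}$. 4. *Directed paths*: for $x,y\in V^{\setminus S}$, replacing every edge by its word of edges of $G$ is a bijection $\Pi^{G^{\setminus S}}(x,y)\to\Pi^G(x,y)$; thus $\pi^{G^{\setminus S}}(x,y)=\pi^G(x,y)$. 5. *Normalized weights*: if $q$ is normalized and $S$ is admissible for $G$, then $q^{\setminus S}$ is normalized on $G^{\setminus S}$. 6. *Total path weights*: $s^{\setminus S}(x|y)=s(x|y)$ for all $x,y\in V^{\setminus S}$. 7. *Synergy*: $w^{\setminus S}$ is the synergy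 function of $v^{\setminus S}$ with respect to $G^{\setminus S}$. 8. *Linearity*: $w^{\setminus S}$ is $R$-linear in $v$; and it is $A$-linear in $v$: if $v=\sum_i v_i\cdot a_i$ is a finite sum with $v_i:V\to R$, $a_i\in A$, then $w^{\setminus S}=\sum_i w_i^{\setminus S}\cdot a_i$, where $w_i$ is the synergy function of $v_i$. It is $R$- and $A$-linear in $v^{\setminus S}$ too: for arbitrary value functions, $v^{\setminus S}=r_1v_1^{\setminus S}+r_2v_2^{\setminus S}$ with $r_1,r_2\in R$ (resp. $v^{\setminus S}=\sum_i v_i^{\setminus S}\cdot a_i$) if and only if $w^{\setminus S}=r_1w_1^{\setminus S}+r_2w_2^{\setminus S}$ (resp. $w^{\setminus S}=\sum_i w_i^{\setminus S}\cdot a_i$). 9. *Null elements*: if $y\in V^{\setminus S}$ is a null element for $(G,v)$, then it is a null element for $(G^{\setminus S},v^{\setminus S})$. 10. *Efficiency*: if $q$ is normalized and $S\cap\mathrm{Rt}(G)$ is empty or consists only of null elements for $(G,v)$, then $\sum_{x\in V^{\setminus S}}w^{\setminus S}(x)=\sum_{x\in V}w(x)$. 11. *Commutativity*: if $U\subseteq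 V$ is disjoint from $S$, then $(G^{\setminus S})^{\setminus U}=(G^{\setminus U})^{\setminus S}$, $(q^{\setminus S})^{\setminus U}=(q^{\setminus U})^{\setminus S}$, $(w^{\setminus S})^{\setminus U}=(w^{\setminus U})^{\setminus S}$ and $(v^{\setminus S})^{\setminus U}=(v^{\setminus U})^{\setminus S}$. 12. *Weak elements*: if $S$ and $U\subseteq V$ are disjoint sets of weak elements for $(G,v)$, then $U$ consists of weak elements for $(G^{\setminus S},v^{\setminus S})$. 13. *Element weights*: if $S$ is admissible for $G$, then for all $\varsigma:E\to R$ and $\tau:\mathrm{Rt}(G)\to R$ we have $\tau^{\setminus S}=\tau|_{V\setminus S}$. -/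

import Mathlib

open Finset

universe u v

/-- `r` is a topological ordering of the directed multigraph with vertex set `verts` and edges
`e : E` running from `tail e` to `head e`: a strict total order of the vertices that increases
along every edge. -/
structure IsTopologicalOrder {V : Type u} {E : Type v} (verts : Finset V) (tail head : E → V)
    (r : V → V → Prop) : Prop where
  irrefl : ∀ x ∈ verts, ¬ r x x
  trans : ∀ x ∈ verts, ∀ y ∈ verts, ∀ z ∈ verts, r x y → r y z → r x z
  total : ∀ x ∈ verts, ∀ y ∈ verts, r x y ∨ x = y ∨ r y x
  edge : ∀ e : E, r (tail e) (head e)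

/-- A directed acyclic multigraph: a finite vertex set (inside an ambient type `V`), a finite type
of (possibly parallel) edges with tail and head, and some topological ordering. -/
structure DAMG (V : Type u) where
  verts : Finset V
  E : Type v
  [fintypeE : Fintype E]
  tail : E → V
  head : E → V
  tail_mem : ∀ e, tail e ∈ verts
  head_mem : ∀ e, head e ∈ verts
  exists_order : ∃ r : V → V → Prop, IsTopologicalOrder verts tail head r

attribute [instance] DAMG.fintypeE

namespace DAMG

variable {V : Type u}

/-- The list of consecutive edges `p` is a directed path from `x` to `y` in `G`. The empty list is
the trivial path at a vertex. -/
def IsPath (G : DAMG.{u, v} V) : V → V → List G.E → Prop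
  | x, y, [] => x ∈ G.verts ∧ x = y
  | x, y, e :: p => G.tail e = x ∧ G.IsPath (G.head e) y p

/-- The set of directed paths from `x` to `y`. -/
def paths (G : DAMG.{u, v} V) (x y : V) : Set (List G.E) := {p | G.IsPath x y p}

/-- The number of directed paths from `x` to `y` (a finite number, see `paths_finite`). -/
noncomputable def pathCount (G : DAMG.{u, v} V) (x y : V) : ℕ := (G.paths x y).ncard

open Classical in
/-- The set of parents of `x`. -/
noncomputable def pa (G : DAMG.{u, v} V) (x : V) : Finset V :=
  G.verts.filter fun y => ∃ e, G.tail e = y ∧ G.head e = x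

open Classical in
/-- The set of ancestors of `x`, including `x` itself. -/
noncomputable def anc (G : DAMG.{u, v} V) (x : V) : Finset V :=
  G.verts.filter fun y => ∃ p, G.IsPath y x p

open Classical in
/-- The set of descendants of `x`, including `x` itself. -/
noncomputable def desc (G : DAMG.{u, v} V) (x : V) : Finset V :=
  G.verts.filter fun y => ∃ p, G.IsPath x y p

/-- The set of roots, i.e. of vertices without parents. -/
noncomputable def roots (G : DAMG.{u, v} V) : Finset V :=
  open Classical in G.verts.filter fun x => G.pa x = ∅

theorem IsPath.left_mem {G : DAMG.{u, v} V} {x y : V} {p : List G.E} (h : G.IsPath x y p) :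
    x ∈ G.verts := by
  cases p with
  | nil => exact h.1
  | cons e p => exact h.1 ▸ G.tail_mem e

theorem IsPath.right_mem {G : DAMG.{u, v} V} {y : V} {p : List G.E} :
    ∀ {x : V}, G.IsPath x y p → y ∈ G.verts := by
  induction p with
  | nil => intro x h; exact h.2 ▸ h.1
  | cons e p ih => intro x h; exact ih h.2

theorem IsPath.append {G : DAMG.{u, v} V} {y z : V} {p p' : List G.E} :
    ∀ {x : V}, G.IsPath x y p → G.IsPath y z p' → G.IsPath x z (p ++ p') := by
  induction p with
  | nil => intro x h h'; obtain ⟨_, rfl⟩ := h; exact h'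
  | cons e p ih => intro x h h'; exact ⟨h.1, ih h.2 h'⟩

theorem IsPath.rel {G : DAMG.{u, v} V} {r : V → V → Prop}
    (hr : IsTopologicalOrder G.verts G.tail G.head r) {y : V} {p : List G.E} :
    ∀ {x : V}, G.IsPath x y p → p ≠ [] → r x y := by
  induction p with
  | nil => intro x _ h; exact absurd rfl h
  | cons e p ih =>
    intro x h _
    obtain ⟨rfl, h⟩ := h
    by_cases hp : p = []
    · subst hp; obtain ⟨_, rfl⟩ := h; exact hr.edge e
    · exact hr.trans _ (G.tail_mem e) _ (G.head_mem e) _ h.right_mem (hr.edge e) (ih h hp)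

theorem IsPath.exists_split {G : DAMG.{u, v} V} {e : G.E} {y : V} {p : List G.E} :
    ∀ {x : V}, G.IsPath x y p → e ∈ p → ∃ p', G.IsPath x (G.tail e) p' := by
  induction p with
  | nil => intro x _ h; simp at h
  | cons f p ih =>
    intro x h he
    rcases List.mem_cons.1 he with rfl | he
    · exact ⟨[], h.1 ▸ G.tail_mem e, h.1.symm⟩
    · obtain ⟨p', hp'⟩ := ih h.2 he
      exact ⟨f :: p', h.1, hp'⟩

theorem IsPath.nodup {G : DAMG.{u, v} V} {y : V} {p : List G.E} :
    ∀ {x : V}, G.IsPath x y p → p.Nodup := by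
  induction p with
  | nil => intro x _; exact List.nodup_nil
  | cons e p ih =>
    intro x h
    refine List.nodup_cons.2 ⟨fun he => ?_, ih h.2⟩
    obtain ⟨r, hr⟩ := G.exists_order
    obtain ⟨p', hp'⟩ := h.2.exists_split he
    have h1 : G.IsPath (G.tail e) (G.tail e) (e :: p') := ⟨rfl, hp'⟩
    exact hr.irrefl _ (G.tail_mem e) (h1.rel hr (by simp))

theorem paths_finite (G : DAMG.{u, v} V) (x y : V) : (G.paths x y).Finite := by
  classical
  exact (List.finite_length_le G.E (Fintype.card G.E)).subset fun p hp =>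
    List.Nodup.length_le_card (IsPath.nodup hp)

theorem card_anc_lt (G : DAMG.{u, v} V) {x y : V} (h : y ∈ G.anc x) (hne : y ≠ x) :
    (G.anc y).card < (G.anc x).card := by
  classical
  obtain ⟨hy, p, hp⟩ := Finset.mem_filter.1 h
  refine Finset.card_lt_card (Finset.ssubset_iff_of_subset ?_ |>.2 ⟨x, ?_, ?_⟩)
  · intro z hz
    obtain ⟨hz, p', hp'⟩ := Finset.mem_filter.1 hz
    exact Finset.mem_filter.2 ⟨hz, _, hp'.append hp⟩
  · exact Finset.mem_filter.2 ⟨hp.right_mem, [], hp.right_mem, rfl⟩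
  · intro hx
    obtain ⟨hx, p', hp'⟩ := Finset.mem_filter.1 hx
    obtain ⟨r, hr⟩ := G.exists_order
    have hpne : p ≠ [] := by rintro rfl; exact hne hp.2
    exact hr.irrefl _ hy ((hp.append hp').rel hr (by simp [hpne]))

theorem card_anc_lt_of_mem_pa (G : DAMG.{u, v} V) {x y : V} (h : y ∈ G.pa x) :
    (G.anc y).card < (G.anc x).card := by
  classical
  obtain ⟨hy, e, rfl, rfl⟩ := Finset.mem_filter.1 h
  obtain ⟨r, hr⟩ := G.exists_order
  refine G.card_anc_lt (Finset.mem_filter.2 ⟨hy, [e], rfl, G.head_mem e, rfl⟩) fun hne => ?_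
  have := hr.edge e
  rw [hne] at this
  exact hr.irrefl _ (G.head_mem e) this

variable [DecidableEq V]

/-! Edge weights, total path weights, element weights. Weight functions on roots, value functions
and synergy functions are total functions on the ambient type `V`; only their values at the
relevant vertices matter. -/

section Weights

variable {R : Type*} [CommRing R]

/-- The pairwise weight: the sum of the weights of all edges from `x` to `y`. -/
def pairWeight (G : DAMG.{u, v} V) (q : G.E → R) (x y : V) : R :=
  ∑ e : G.E with G.tail e = x ∧ G.head e = y, q e

/-- The weights of the incoming edges of every non-root sum to one. -/
def IsNormalized (G : DAMG.{u, v} V) (q : G.E → R) : Prop :=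
  ∀ y ∈ G.verts, y ∉ G.roots → ∑ x ∈ G.verts, G.pairWeight q x y = 1

/-- The total path weight function. -/
noncomputable def totalPathWeight (G : DAMG.{u, v} V) (q : G.E → R) (x y : V) : R :=
  if y ∉ G.desc x then 0
  else if y = x then 1
  else ∑ z ∈ (G.pa y).attach, G.totalPathWeight q x z.1 * G.pairWeight q z.1 y
termination_by (G.anc y).card
decreasing_by exact G.card_anc_lt_of_mem_pa z.2

/-- The element weights: the recursive extension of a root weight function `τ` (only used at the
roots) to all vertices, by means of the edge weight function `ς`. -/
noncomputable def elementWeight (G : DAMG.{u, v} V) (ς : G.E → R) (τ : V → R) (y : V) : R :=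
  if y ∈ G.roots then τ y
  else ∑ z ∈ (G.pa y).attach, G.elementWeight ς τ z.1 * G.pairWeight ς z.1 y
termination_by (G.anc y).card
decreasing_by exact G.card_anc_lt_of_mem_pa z.2

end Weights

section Synergy

variable {A : Type*} [AddCommGroup A]

/-- The synergy function (Möbius transform) of the value function `f`. -/
noncomputable def synergy (G : DAMG.{u, v} V) (f : V → A) (x : V) : A :=
  f x - ∑ y ∈ ((G.anc x).erase x).attach, G.synergy f y.1
termination_by (G.anc x).card
decreasing_by
  exact G.card_anc_lt (Finset.mem_of_mem_erase y.2) (Finset.ne_of_mem_erase y.2)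

/-- The vertex `z` is a weak element: its synergy vanishes. -/
def IsWeak (G : DAMG.{u, v} V) (f : V → A) (z : V) : Prop :=
  z ∈ G.verts ∧ G.synergy f z = 0

/-- The vertex `y` is a null element: the synergies of all its descendants vanish. -/
def IsNull (G : DAMG.{u, v} V) (f : V → A) (y : V) : Prop :=
  y ∈ G.verts ∧ ∀ x ∈ G.desc y, G.synergy f x = 0

end Synergy

/-! Projection onto the complement of one vertex `z`. -/

/-- Edges of `G` that avoid `z`, together with one composite edge for every pair of consecutive
edges through `z`. -/
def ProjEdge (G : DAMG.{u, v} V) (z : V) : Type v :=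
  {e : G.E // G.tail e ≠ z ∧ G.head e ≠ z} ⊕
    {p : G.E × G.E // (G.head p.1 = z ∧ G.tail p.2 = z) ∧ (G.tail p.1 ≠ z ∧ G.head p.2 ≠ z)}

instance (G : DAMG.{u, v} V) (z : V) : Fintype (G.ProjEdge z) :=
  inferInstanceAs (Fintype (_ ⊕ _))

/-- The projection of `G` onto the complement of `z`. -/
def projOne (G : DAMG.{u, v} V) (z : V) : DAMG.{u, v} V where
  verts := G.verts.erase z
  E := G.ProjEdge z
  tail := fun e => match e with
    | .inl e => G.tail e.1
    | .inr p => G.tail p.1.1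
  head := fun e => match e with
    | .inl e => G.head e.1
    | .inr p => G.head p.1.2
  tail_mem := by
    rintro (e | p)
    · exact Finset.mem_erase.2 ⟨e.2.1, G.tail_mem _⟩
    · exact Finset.mem_erase.2 ⟨p.2.2.1, G.tail_mem _⟩
  head_mem := by
    rintro (e | p)
    · exact Finset.mem_erase.2 ⟨e.2.2, G.head_mem _⟩
    · exact Finset.mem_erase.2 ⟨p.2.2.2, G.head_mem _⟩
  exists_order := by
    obtain ⟨r, hr⟩ := G.exists_order
    refine ⟨r, fun x hx => hr.irrefl x (mem_of_mem_erase hx),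
      fun x hx y hy z hz => hr.trans x (mem_of_mem_erase hx) y (mem_of_mem_erase hy) z
        (mem_of_mem_erase hz),
      fun x hx y hy => hr.total x (mem_of_mem_erase hx) y (mem_of_mem_erase hy), ?_⟩
    rintro (e | ⟨⟨e₁, e₂⟩, ⟨h₁, h₂⟩, _⟩)
    · exact hr.edge _
    · have h := hr.edge e₂
      have h' := hr.edge e₁
      simp only at h₁ h₂
      rw [h₂, ← h₁] at h
      exact hr.trans _ (G.tail_mem _) _ (G.head_mem _) _ (G.head_mem _) h' h

/-- The word of edges of `G` that an edge of the projection stands for. -/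
def expandOne (G : DAMG.{u, v} V) (z : V) : (G.projOne z).E → List G.E
  | .inl e => [e.1]
  | .inr p => [p.1.1, p.1.2]

/-- The projected weight function: composite edges get the product weight. -/
def weightOne {R : Type*} [CommRing R] (G : DAMG.{u, v} V) (q : G.E → R) (z : V) :
    (G.projOne z).E → R
  | .inl e => q e.1
  | .inr p => q p.1.1 * q p.1.2

section

variable {R : Type*} [CommRing R] {A : Type*} [AddCommGroup A] [Module R A]

/-- The projected synergy function. -/
def synergyOne (G : DAMG.{u, v} V) (q : G.E → R) (w : V → A) (z : V) : V → A :=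
  fun x => w x + G.pairWeight q x z • w z

/-! Successive projection along a list of vertices, and projection along a finite set of vertices
(the elements of the set are projected out one after the other, in some order). -/

/-- The graph after projecting out the vertices of a list one after the other. -/
def projList (G : DAMG.{u, v} V) : List V → DAMG.{u, v} V
  | [] => G
  | z :: l => (G.projOne z).projList l

/-- The word of edges of `G` that an edge of the successive projection stands for. -/
def expandList (G : DAMG.{u, v} V) : (l : List V) → (G.projList l).E → List G.E
  | [] => fun e => [e]
  | z :: l => fun e => ((G.projOne z).expandList l e).flatMap (G.expandOne z)

def weightList (G : DAMG.{u, v} V) (q : G.E → R) : (l : List V) → (G.projList l).E → R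
  | [] => q
  | z :: l => (G.projOne z).weightList (G.weightOne q z) l

def synergyList (G : DAMG.{u, v} V) (q : G.E → R) (w : V → A) : List V → V → A
  | [] => w
  | z :: l => (G.projOne z).synergyList (G.weightOne q z) (G.synergyOne q w z) l

/-- The projected graph `G^{∖S}`. -/
noncomputable def proj (G : DAMG.{u, v} V) (S : Finset V) : DAMG.{u, v} V :=
  G.projList S.toList

noncomputable def expand (G : DAMG.{u, v} V) (S : Finset V) : (G.proj S).E → List G.E :=
  G.expandList S.toList

/-- The projected weight function `q^{∖S}`. -/
noncomputable def projWeight (G : DAMG.{u, v} V) (q : G.E → R) (S : Finset V) :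
    (G.proj S).E → R :=
  G.weightList q S.toList

/-- The projected synergy function `w^{∖S}`. -/
noncomputable def projSynergy (G : DAMG.{u, v} V) (q : G.E → R) (w : V → A) (S : Finset V) :
    V → A :=
  G.synergyList q w S.toList

/-- The projected value function `v^{∖S}` of the value function `f = v`. -/
noncomputable def projValue (G : DAMG.{u, v} V) (q : G.E → R) (f : V → A) (S : Finset V)
    (y : V) : A :=
  ∑ x ∈ (G.proj S).anc y, G.projSynergy q (G.synergy f) S x

end

/-- With `T = S ∖ Rt(G)` and `U = S ∩ Rt(G)`: every vertex of `G^{∖T}` that has a parent in `U`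
has all its parents in `U`. -/
def IsAdmissible (G : DAMG.{u, v} V) (S : Finset V) : Prop :=
  ∀ y ∈ (G.proj (S \ G.roots)).verts,
    ((G.proj (S \ G.roots)).pa y ∩ (S ∩ G.roots)).Nonempty →
      (G.proj (S \ G.roots)).pa y ⊆ S ∩ G.roots

/-- Two edge weighted graphs `(H, q)`, `(K, q')`, whose edges stand for words in a common alphabet,
are the same: they have the same vertices, and a bijection between their edges preserves tails,
heads, words and weights. -/
def SameGraph {R L : Type*} (H K : DAMG.{u, v} V) (ε : H.E → List L) (ε' : K.E → List L)
    (q : H.E → R) (q' : K.E → R) : Prop :=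
  H.verts = K.verts ∧ ∃ φ : H.E ≃ K.E, ∀ e,
    K.tail (φ e) = H.tail e ∧ K.head (φ e) = H.head e ∧ ε' (φ e) = ε e ∧ q' (φ e) = q e

end DAMG

namespace DAMG

variable {V : Type u}

/-! Three descriptions of the projection, none of which refers to an order of elimination, carry the
proof.

Combinatorics (`IsProjection`): the edges of the projection along `X` correspond, via their words,
exactly to the paths of `G` with all interior vertices in `X` and both ends outside. This is clear
for one vertex, and `IsProjection.comp` shows that it composes along unions. As the set of words
depends only on `X`, and weights are products along words, `IsProjection.sameGraph` gives
independence of the order and commutativity. Cutting a path of `G` at its vertices outside `X` gives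
the bijection of paths, hence the ancestors.

Weights (`IsHarmonicOff`): total path weights, element weights and, for normalized `q`, the constant
1 all satisfy `f y = ∑ f x * q(x|y)` off an exceptional set, on which they are prescribed.
Substituting the equation at `z` into the others shows that eliminating `z` preserves the equations,
and acyclicity makes the solution unique. Exceptional vertices may not be eliminated this way;
admissibility handles roots.

Synergies (`IsSolution`): projecting `w` is Gaussian elimination for the triangular system `W x = w
x + ∑ y ∈ X, q(x|y) W y`, and the projected synergy is `W` outside `X`. Linearity, vanishing at null
and weak elements, efficiency and commutativity are read off from this system. -/

theorem mem_pa {G : DAMG.{u, v} V} {x y : V} :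
    y ∈ G.pa x ↔ ∃ e, G.tail e = y ∧ G.head e = x := by
  classical
  rw [pa, Finset.mem_filter]
  exact ⟨fun h => h.2, fun h => ⟨by obtain ⟨e, rfl, _⟩ := h; exact G.tail_mem e, h⟩⟩

theorem mem_anc {G : DAMG.{u, v} V} {x y : V} : y ∈ G.anc x ↔ ∃ p, G.IsPath y x p := by
  classical
  rw [anc, Finset.mem_filter]
  exact ⟨fun h => h.2, fun h => ⟨by obtain ⟨p, hp⟩ := h; exact hp.left_mem, h⟩⟩

theorem mem_desc {G : DAMG.{u, v} V} {x y : V} : y ∈ G.desc x ↔ ∃ p, G.IsPath x y p := by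
  classical
  rw [desc, Finset.mem_filter]
  exact ⟨fun h => h.2, fun h => ⟨by obtain ⟨p, hp⟩ := h; exact hp.right_mem, h⟩⟩

theorem mem_roots {G : DAMG.{u, v} V} {x : V} :
    x ∈ G.roots ↔ x ∈ G.verts ∧ ∀ e, G.head e ≠ x := by
  classical
  rw [roots, Finset.mem_filter, Finset.eq_empty_iff_forall_notMem]
  refine and_congr_right fun _ => ⟨fun h e he => h _ (mem_pa.2 ⟨e, rfl, he⟩), fun h y hy => ?_⟩
  obtain ⟨e, _, he⟩ := mem_pa.1 hy
  exact h e he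

theorem mem_anc_self {G : DAMG.{u, v} V} {x : V} (hx : x ∈ G.verts) : x ∈ G.anc x :=
  mem_anc.2 ⟨[], hx, rfl⟩

theorem mem_desc_self {G : DAMG.{u, v} V} {x : V} (hx : x ∈ G.verts) : x ∈ G.desc x :=
  mem_desc.2 ⟨[], hx, rfl⟩

theorem anc_subset_verts (G : DAMG.{u, v} V) (x : V) : G.anc x ⊆ G.verts := fun _ hy =>
  (mem_anc.1 hy).elim fun _ hp => hp.left_mem

theorem tail_ne_head (G : DAMG.{u, v} V) (e : G.E) : G.tail e ≠ G.head e := by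
  intro h
  obtain ⟨r, hr⟩ := G.exists_order
  have := hr.edge e
  rw [h] at this
  exact hr.irrefl _ (G.head_mem e) this

/-- Induction along the edges: a property passes from the parents to a vertex. -/
theorem induction_parents (G : DAMG.{u, v} V) {p : V → Prop}
    (h : ∀ x, (∀ e, G.head e = x → p (G.tail e)) → p x) (x : V) : p x := by
  induction hn : (G.anc x).card using Nat.strong_induction_on generalizing x with
  | _ n ih =>
    subst hn
    exact h x fun e he => ih _ (G.card_anc_lt_of_mem_pa (mem_pa.2 ⟨e, rfl, he⟩)) _ rfl

/-- Induction against the edges: a property passes from the children to a vertex. -/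
theorem induction_children (G : DAMG.{u, v} V) {p : V → Prop}
    (h : ∀ x, (∀ e, G.tail e = x → p (G.head e)) → p x) (x : V) : p x := by
  classical
  obtain ⟨r, hr⟩ := G.exists_order
  induction hn : (G.verts.filter (r x)).card using Nat.strong_induction_on generalizing x with
  | _ n ih =>
    subst hn
    refine h x fun e he => ih _ (Finset.card_lt_card ?_) _ rfl
    have hxe : r x (G.head e) := he ▸ hr.edge e
    refine Finset.ssubset_iff_of_subset ?_ |>.2 ⟨G.head e, ?_, ?_⟩
    · intro y hy
      obtain ⟨hy, hy'⟩ := Finset.mem_filter.1 hy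
      exact Finset.mem_filter.2
        ⟨hy, hr.trans _ (he ▸ G.tail_mem e) _ (G.head_mem e) _ hy hxe hy'⟩
    · exact Finset.mem_filter.2 ⟨G.head_mem e, hxe⟩
    · exact fun h => hr.irrefl _ (G.head_mem e) (Finset.mem_filter.1 h).2

/-! ### Paths through a vertex set -/

/-- `p` is a nonempty path from `x` to `y` whose interior vertices belong to `X`. -/
inductive IsThrough (G : DAMG.{u, v} V) (X : Finset V) : V → V → List G.E → Prop
  | single (e : G.E) : IsThrough G X (G.tail e) (G.head e) [e]
  | cons (e : G.E) {y : V} {p : List G.E} (he : G.head e ∈ X)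
      (hp : IsThrough G X (G.head e) y p) : IsThrough G X (G.tail e) y (e :: p)

namespace IsThrough

variable {G : DAMG.{u, v} V} {X Y : Finset V} {x y z : V} {p : List G.E}

theorem mono (h : G.IsThrough X x y p) (hXY : X ⊆ Y) : G.IsThrough Y x y p := by
  induction h with
  | single e => exact single e
  | cons e he _ ih => exact cons e (hXY he) ih

theorem append {p' : List G.E} (h : G.IsThrough X x y p) (hy : y ∈ X)
    (h' : G.IsThrough X y z p') : G.IsThrough X x z (p ++ p') := by
  induction h with
  | single e => exact cons e hy h'
  | cons e he _ ih => exact cons e he (ih hy h')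

theorem isPath (h : G.IsThrough X x y p) : G.IsPath x y p := by
  induction h with
  | single e => exact ⟨rfl, G.head_mem e, rfl⟩
  | cons e he _ ih => exact ⟨rfl, ih⟩

theorem exists_head_eq (h : G.IsThrough X x y p) : ∃ e, G.head e = y := by
  induction h with
  | single e => exact ⟨e, rfl⟩
  | cons e he _ ih => exact ih

theorem ne_nil (h : G.IsThrough X x y p) : p ≠ [] := by
  cases h <;> simp

/-- A nonempty word of edges determines its end vertices. Hence matching edges of two projections by
their words also matches tails and heads. -/
theorem left_unique {x' y' : V} (h : G.IsThrough X x y p) (h' : G.IsThrough Y x' y' p) :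
    x = x' := by
  cases h <;> cases h' <;> rfl

theorem right_unique {x' y' : V} (h : G.IsThrough X x y p) (h' : G.IsThrough Y x' y' p) :
    y = y' := by
  induction h generalizing x' with
  | single e =>
    cases h' with
    | single => rfl
    | cons _ _ hp => exact absurd rfl hp.ne_nil
  | cons e he hp ih =>
    cases h' with
    | single => exact absurd rfl hp.ne_nil
    | cons _ _ hp' => exact ih hp'

/-- The paths through `X` that end outside of `X` form a prefix code. -/
theorem append_inj {x' y' : V} {p' a b : List G.E} (h : G.IsThrough X x y p) (hy : y ∉ X)
    (h' : G.IsThrough X x' y' p') (hy' : y' ∉ X) (hab : p ++ a = p' ++ b) : p = p' ∧ a = b := by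
  induction h generalizing x' p' with
  | single e =>
    cases h' with
    | single e' => simpa using hab
    | cons e' he' hp' =>
      simp only [List.cons_append, List.nil_append, List.cons.injEq] at hab
      -- The shared first edge would end both outside `X`, where one path stops, and inside `X`,
      -- where the other continues.
      exact absurd (hab.1 ▸ he') hy
  | cons e he hp ih =>
    cases h' with
    | single e' =>
      simp only [List.cons_append, List.nil_append, List.cons.injEq] at hab
      exact absurd (hab.1 ▸ he) hy'
    | cons e' he' hp' =>
      simp only [List.cons_append, List.cons.injEq] at hab
      obtain ⟨rfl, hab⟩ := hab
      obtain ⟨rfl, rfl⟩ := ih hy hp' hab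
      exact ⟨rfl, rfl⟩

/-- An interior vertex has an incoming edge, so it cannot be a root: the path is a single edge. -/
theorem of_subset_roots (hX : X ⊆ G.roots) (h : G.IsThrough X x y p) :
    x ∈ G.pa y := by
  cases h with
  | single e => exact mem_pa.2 ⟨e, rfl, rfl⟩
  | cons e he hp => exact absurd rfl ((mem_roots.1 (hX he)).2 e)

end IsThrough

/-! ### Projections described by words of edges -/

variable [DecidableEq V]

/-- The edges of `H` stand for words of edges of `G`, namely for the paths whose interior
vertices belong to `X` and whose end vertices do not, and the vertices of `H` are those of `G`
outside of `X`. -/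
structure IsProjection (G : DAMG.{u, v} V) (X : Finset V) (H : DAMG.{u, v} V)
    (ε : H.E → List G.E) : Prop where
  verts_eq : H.verts = G.verts \ X
  isThrough : ∀ e, G.IsThrough X (H.tail e) (H.head e) (ε e)
  injective : Function.Injective ε
  exists_eq : ∀ {x y p}, G.IsThrough X x y p → x ∉ X → y ∉ X → ∃ e, ε e = p

namespace IsProjection

variable {G H K : DAMG.{u, v} V} {X Y : Finset V} {ε : H.E → List G.E} {ε' : K.E → List H.E}

theorem tail_notMem (h : G.IsProjection X H ε) (e : H.E) : H.tail e ∉ X :=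
  (Finset.mem_sdiff.1 (h.verts_eq ▸ H.tail_mem e)).2

theorem head_notMem (h : G.IsProjection X H ε) (e : H.E) : H.head e ∉ X :=
  (Finset.mem_sdiff.1 (h.verts_eq ▸ H.head_mem e)).2

theorem exists_edge (h : G.IsProjection X H ε) {x y : V} {p : List G.E}
    (hp : G.IsThrough X x y p) (hx : x ∉ X) (hy : y ∉ X) :
    ∃ e, H.tail e = x ∧ H.head e = y ∧ ε e = p := by
  obtain ⟨e, rfl⟩ := h.exists_eq hp hx hy
  exact ⟨e, (h.isThrough e).left_unique hp, (h.isThrough e).right_unique hp, rfl⟩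

/-- The words of edges of `H` form a prefix code, so a concatenation of them is decoded uniquely
from the left. -/
theorem flatMap_injective (h : G.IsProjection X H ε) :
    Function.Injective fun p : List H.E => p.flatMap ε := by
  intro p
  induction p with
  | nil =>
    rintro (_ | ⟨e, p'⟩) hp
    · rfl
    · simp only [List.flatMap_nil, List.flatMap_cons, List.nil_eq, List.append_eq_nil_iff] at hp
      exact absurd hp.1 (h.isThrough e).ne_nil
  | cons e p ih =>
    rintro (_ | ⟨e', p'⟩) hp
    · simp only [List.flatMap_nil, List.flatMap_cons, List.append_eq_nil_iff] at hp
      exact absurd hp.1 (h.isThrough e).ne_nil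
    · simp only [List.flatMap_cons] at hp
      obtain ⟨h1, h2⟩ := (h.isThrough e).append_inj (h.head_notMem e) (h.isThrough e')
        (h.head_notMem e') hp
      rw [h.injective h1, ih h2]

theorem isThrough_flatMap (h : G.IsProjection X H ε) {x y : V} {p : List H.E}
    (hp : H.IsThrough Y x y p) : G.IsThrough (X ∪ Y) x y (p.flatMap ε) := by
  induction hp with
  | single e => simpa using (h.isThrough e).mono subset_union_left
  | cons e he _ ih =>
    exact ((h.isThrough e).mono subset_union_left).append (mem_union_right _ he) ih

/-- Decoding: cut `p` at its vertices outside `X`; the pieces between consecutive cuts are words of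
edges of `H`. The first piece `p₁` is kept apart because `x` may lie in `X`, which the induction
needs. -/
theorem exists_isThrough (h : G.IsProjection X H ε) {x y : V} {p : List G.E}
    (hp : G.IsThrough (X ∪ Y) x y p) (hy : y ∉ X) :
    ∃ m p₁ p₂, m ∉ X ∧ G.IsThrough X x m p₁ ∧ p = p₁ ++ p₂.flatMap ε ∧
      ((p₂ = [] ∧ m = y) ∨ (m ∈ Y ∧ H.IsThrough Y m y p₂)) := by
  induction hp with
  | single e => exact ⟨_, [e], [], hy, .single e, rfl, .inl ⟨rfl, rfl⟩⟩
  | cons e he hp ih =>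
    obtain ⟨m, p₁, p₂, hm, hp₁, rfl, h'⟩ := ih hy
    by_cases heX : G.head e ∈ X
    · exact ⟨m, e :: p₁, p₂, hm, .cons e heX hp₁, rfl, h'⟩
    -- The path leaves `X` here, so the current piece closes up to an edge `f` of `H` and a new
    -- piece starts with `e`.
    · obtain ⟨f, hf, rfl, rfl⟩ := h.exists_edge hp₁ heX hm
      refine ⟨_, [e], f :: p₂, heX, .single e, rfl, .inr ⟨?_, ?_⟩⟩
      · exact (mem_union.1 he).resolve_left heX
      · rw [← hf]
        obtain ⟨rfl, rfl⟩ | ⟨hmY, h'⟩ := h'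
        · exact .single f
        · exact .cons f hmY h'

theorem comp (h : G.IsProjection X H ε) (h' : H.IsProjection Y K ε') :
    G.IsProjection (X ∪ Y) K fun e => (ε' e).flatMap ε where
  verts_eq := by rw [h'.verts_eq, h.verts_eq, sdiff_sdiff_left]; rfl
  isThrough e := h.isThrough_flatMap (h'.isThrough e)
  injective := h.flatMap_injective.comp h'.injective
  exists_eq := by
    intro x y p hp hx hy
    simp only [mem_union, not_or] at hx hy
    obtain ⟨m, p₁, p₂, hm, hp₁, rfl, h''⟩ := h.exists_isThrough hp hy.1
    obtain ⟨f, rfl, rfl, rfl⟩ := h.exists_edge hp₁ hx.1 hm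
    have : H.IsThrough Y (H.tail f) y (f :: p₂) := by
      obtain ⟨rfl, rfl⟩ | ⟨hmY, h'⟩ := h''
      · exact .single f
      · exact .cons f hmY h'
    obtain ⟨e, he⟩ := h'.exists_eq this hx.2 hy.2
    exact ⟨e, by simp [he]⟩

theorem refl (G : DAMG.{u, v} V) : G.IsProjection ∅ G fun e => [e] where
  verts_eq := by simp
  isThrough e := .single e
  injective _ _ h := by simpa using h
  exists_eq := by
    intro x y p hp _ _
    cases hp with
    | single e => exact ⟨e, rfl⟩
    | cons e he => simp at he

theorem projOne (G : DAMG.{u, v} V) (z : V) :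
    G.IsProjection {z} (G.projOne z) (G.expandOne z) where
  verts_eq := (sdiff_singleton_eq_erase z G.verts).symm
  isThrough := by
    rintro (e | ⟨⟨e₁, e₂⟩, ⟨h₁, h₂⟩, h₃⟩)
    · exact .single e.1
    · simp only at h₁ h₂
      refine .cons e₁ (by simp [h₁]) ?_
      have h := IsThrough.single (X := {z}) e₂
      rw [h₂.trans h₁.symm] at h
      exact h
  injective := by
    rintro (e | p) (e' | p') h
    · simp only [expandOne, List.cons.injEq, and_true] at h
      rw [Subtype.ext h]
    · simp [expandOne] at h
    · simp [expandOne] at h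
    · simp only [expandOne, List.cons.injEq, and_true] at h
      rw [Subtype.ext (Prod.ext h.1 h.2)]
  exists_eq := by
    intro x y p hp hx hy
    simp only [mem_singleton] at hx hy
    cases hp with
    | single e => exact ⟨.inl ⟨e, hx, hy⟩, rfl⟩
    | cons e he hp =>
      rw [mem_singleton] at he
      generalize hm : G.head e = m at he hp
      cases hp with
      | single f => exact ⟨.inr ⟨(e, f), ⟨hm.trans he, he⟩, hx, hy⟩, rfl⟩
      -- A word of length three or more would contain a loop at `z`.
      | cons f hf _ => exact absurd (he.trans (mem_singleton.1 hf).symm) (G.tail_ne_head f)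

theorem projList (G : DAMG.{u, v} V) (l : List V) :
    G.IsProjection l.toFinset (G.projList l) (G.expandList l) := by
  induction l generalizing G with
  | nil => exact refl G
  | cons z l ih =>
    rw [List.toFinset_cons, insert_eq]
    exact (projOne G z).comp (ih _)

theorem proj (G : DAMG.{u, v} V) (S : Finset V) : G.IsProjection S (G.proj S) (G.expand S) := by
  have := projList G S.toList
  rwa [toList_toFinset] at this

theorem isPath_flatMap (h : G.IsProjection X H ε) {x y : V} {p : List H.E}
    (hp : H.IsPath x y p) : G.IsPath x y (p.flatMap ε) := by
  induction p generalizing x with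
  | nil => exact ⟨(mem_sdiff.1 (h.verts_eq ▸ hp.1)).1, hp.2⟩
  | cons e p ih =>
    obtain ⟨rfl, hp⟩ := hp
    exact (h.isThrough e).isPath.append (ih hp)

theorem exists_isPath (h : G.IsProjection X H ε) {x y : V} {p : List G.E}
    (hp : G.IsPath x y p) (hy : y ∉ X) : p = [] ∧ x = y ∨
    ∃ m p₁ p₂, m ∉ X ∧ G.IsThrough X x m p₁ ∧ p = p₁ ++ p₂.flatMap ε ∧ H.IsPath m y p₂ := by
  induction p generalizing x with
  | nil => exact .inl ⟨rfl, hp.2⟩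
  | cons e p ih =>
    obtain ⟨rfl, hp⟩ := hp
    obtain ⟨rfl, rfl⟩ | ⟨m, p₁, p₂, hm, hp₁, rfl, h'⟩ := ih hp
    · exact .inr ⟨_, [e], [], hy, .single e, rfl,
        h.verts_eq ▸ mem_sdiff.2 ⟨G.head_mem e, hy⟩, rfl⟩
    · by_cases heX : G.head e ∈ X
      · exact .inr ⟨m, e :: p₁, p₂, hm, .cons e heX hp₁, rfl, h'⟩
      · obtain ⟨f, hf, rfl, rfl⟩ := h.exists_edge hp₁ heX hm
        exact .inr ⟨_, [e], f :: p₂, heX, .single e, rfl, hf, h'⟩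

theorem bijOn_paths (h : G.IsProjection X H ε) {x y : V} (hx : x ∉ X) (hy : y ∉ X) :
    Set.BijOn (fun p : List H.E => p.flatMap ε) (H.paths x y) (G.paths x y) := by
  refine ⟨fun p hp => h.isPath_flatMap hp, h.flatMap_injective.injOn, fun p hp => ?_⟩
  obtain ⟨rfl, rfl⟩ | ⟨m, p₁, p₂, hm, hp₁, rfl, h'⟩ := h.exists_isPath hp hy
  · exact ⟨[], ⟨h.verts_eq ▸ mem_sdiff.2 ⟨IsPath.left_mem hp, hx⟩, rfl⟩, rfl⟩
  · obtain ⟨f, rfl, rfl, rfl⟩ := h.exists_edge hp₁ hx hm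
    exact ⟨f :: p₂, ⟨rfl, h'⟩, rfl⟩

theorem pathCount_eq (h : G.IsProjection X H ε) {x y : V} (hx : x ∉ X) (hy : y ∉ X) :
    H.pathCount x y = G.pathCount x y := by
  have := h.bijOn_paths hx hy
  rw [pathCount, pathCount, ← this.image_eq, this.injOn.ncard_image]

theorem anc_eq (h : G.IsProjection X H ε) {y : V} (hy : y ∉ X) : H.anc y = G.anc y \ X := by
  ext x
  rw [mem_sdiff, mem_anc, mem_anc]
  constructor
  · rintro ⟨p, hp⟩
    exact ⟨⟨_, h.isPath_flatMap hp⟩, (mem_sdiff.1 (h.verts_eq ▸ hp.left_mem)).2⟩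
  · rintro ⟨⟨p, hp⟩, hx⟩
    obtain ⟨p', hp', -⟩ := (h.bijOn_paths hx hy).surjOn hp
    exact ⟨p', hp'⟩

theorem desc_subset (h : G.IsProjection X H ε) (x : V) : H.desc x ⊆ G.desc x := fun y hy => by
  obtain ⟨p, hp⟩ := mem_desc.1 hy
  exact mem_desc.2 ⟨_, h.isPath_flatMap hp⟩

theorem roots_subset (h : G.IsProjection X H ε) : G.roots \ X ⊆ H.roots := by
  intro x hx
  obtain ⟨hx, hxX⟩ := mem_sdiff.1 hx
  obtain ⟨hx, hx'⟩ := mem_roots.1 hx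
  refine mem_roots.2 ⟨h.verts_eq ▸ mem_sdiff.2 ⟨hx, hxX⟩, fun e he => ?_⟩
  obtain ⟨f, hf⟩ := (h.isThrough e).exists_head_eq
  exact hx' f (hf.trans he)

/-- Walk backwards from `y`: as long as the walk stays in `X` it meets no root and can be continued,
so by acyclicity it leaves `X`. -/
theorem _root_.DAMG.exists_isThrough_of_notMem_roots {X : Finset V} (hX : X ∩ G.roots = ∅) (y : V)
    (hy : y ∈ G.verts) (hyr : y ∉ G.roots) : ∃ x ∉ X, ∃ p, G.IsThrough X x y p := by
  induction y using G.induction_parents with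
  | h y ih =>
    obtain ⟨e, rfl⟩ : ∃ e, G.head e = y := by
      by_contra! h
      exact hyr (mem_roots.2 ⟨hy, h⟩)
    by_cases he : G.tail e ∈ X
    · have : G.tail e ∉ G.roots := fun h => by simpa [hX] using mem_inter.2 ⟨he, h⟩
      obtain ⟨x, hx, p, hp⟩ := ih e rfl (G.tail_mem e) this
      exact ⟨x, hx, _, hp.append he (.single e)⟩
    · exact ⟨_, he, _, .single e⟩

theorem roots_eq (h : G.IsProjection X H ε) (hX : X ∩ G.roots = ∅) : G.roots \ X = H.roots := by
  refine h.roots_subset.antisymm fun y hy => ?_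
  obtain ⟨hy, hyr⟩ := mem_roots.1 hy
  obtain ⟨hy, hyX⟩ := mem_sdiff.1 (h.verts_eq ▸ hy)
  refine mem_sdiff.2 ⟨?_, hyX⟩
  by_contra hyG
  obtain ⟨x, hx, p, hp⟩ := exists_isThrough_of_notMem_roots hX y hy hyG
  obtain ⟨e, -, he, -⟩ := h.exists_edge hp hx hyX
  exact hyr e he

end IsProjection

/-- Two projections of a graph along the same set, with multiplicative weights, are the same. -/
theorem IsProjection.sameGraph {R : Type*} [CommRing R] {G H K : DAMG.{u, v} V} {X : Finset V}
    {ε : H.E → List G.E} {ε' : K.E → List G.E} {q : G.E → R} {qH : H.E → R} {qK : K.E → R}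
    (hH : G.IsProjection X H ε) (hK : G.IsProjection X K ε')
    (hqH : ∀ e, qH e = ((ε e).map q).prod) (hqK : ∀ e, qK e = ((ε' e).map q).prod) :
    SameGraph H K ε ε' qH qK := by
  refine ⟨hH.verts_eq.trans hK.verts_eq.symm, ?_⟩
  -- Both ranges are the set of paths through `X` with ends outside `X`.
  have hr : Set.range ε = Set.range ε' := by
    ext p
    constructor
    · rintro ⟨e, rfl⟩
      exact hK.exists_eq (hH.isThrough e) (hH.tail_notMem e) (hH.head_notMem e)
    · rintro ⟨e, rfl⟩
      exact hH.exists_eq (hK.isThrough e) (hK.tail_notMem e) (hK.head_notMem e)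
  let φ : H.E ≃ K.E := (Equiv.ofInjective ε hH.injective).trans
    ((Equiv.setCongr hr).trans (Equiv.ofInjective ε' hK.injective).symm)
  have hφ : ∀ e, ε' (φ e) = ε e := fun e =>
    Equiv.apply_ofInjective_symm hK.injective _
  refine ⟨φ, fun e => ?_⟩
  have h := hK.isThrough (φ e)
  rw [hφ] at h
  exact ⟨h.left_unique (hH.isThrough e), h.right_unique (hH.isThrough e), hφ e,
    by rw [hqK, hφ, hqH]⟩

/-! ### Weights as products along words -/

section

variable {R : Type*} [CommRing R]

theorem weightOne_eq (G : DAMG.{u, v} V) (q : G.E → R) (z : V) (e : (G.projOne z).E) :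
    G.weightOne q z e = ((G.expandOne z e).map q).prod := by
  rcases e with e | p <;> simp [weightOne, expandOne]

theorem prod_map_flatMap {α β : Type*} (l : List α) (f : α → List β) (q : β → R) :
    ((l.flatMap f).map q).prod = (l.map fun a => ((f a).map q).prod).prod := by
  induction l with
  | nil => simp
  | cons a l ih => simp [ih]

theorem weightList_eq (G : DAMG.{u, v} V) (q : G.E → R) (l : List V) (e : (G.projList l).E) :
    G.weightList q l e = ((G.expandList l e).map q).prod := by
  induction l generalizing G with
  | nil => exact (List.prod_singleton (x := q e)).symm
  | cons z l ih =>
    simp only [weightList, expandList, prod_map_flatMap, ← weightOne_eq]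
    exact ih _ _ e

theorem projWeight_eq (G : DAMG.{u, v} V) (q : G.E → R) (S : Finset V) (e : (G.proj S).E) :
    G.projWeight q S e = ((G.expand S e).map q).prod :=
  G.weightList_eq q _ e

end

/-! ### Pair weights and harmonic functions -/

section

variable {R : Type*} [CommRing R]

theorem pairWeight_eq_zero {G : DAMG.{u, v} V} {x y : V} (q : G.E → R) (h : x ∉ G.pa y) :
    G.pairWeight q x y = 0 := by
  refine Finset.sum_eq_zero fun e he => ?_
  exact absurd (mem_pa.2 ⟨e, (mem_filter.1 he).2⟩) h

theorem pairWeight_self (G : DAMG.{u, v} V) (q : G.E → R) (x : V) : G.pairWeight q x x = 0 := by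
  refine pairWeight_eq_zero q fun h => ?_
  obtain ⟨e, h1, h2⟩ := mem_pa.1 h
  exact G.tail_ne_head e (h1.trans h2.symm)

theorem pairWeight_eq_zero_of_mem_roots {G : DAMG.{u, v} V} {x y : V} (q : G.E → R)
    (h : y ∈ G.roots) : G.pairWeight q x y = 0 := by
  refine pairWeight_eq_zero q fun h' => ?_
  obtain ⟨e, -, he⟩ := mem_pa.1 h'
  exact (mem_roots.1 h).2 e he

/-- The composite edges from `x` to `y` are all pairs of an edge into `z` and an edge out of `z`, so
their weights sum to a product. This elimination formula is all that the linear algebra below uses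
about the weights of the projected graph. -/
theorem pairWeight_projOne (G : DAMG.{u, v} V) (q : G.E → R) {x y z : V} (hx : x ≠ z)
    (hy : y ≠ z) : (G.projOne z).pairWeight (G.weightOne q z) x y =
      G.pairWeight q x y + G.pairWeight q x z * G.pairWeight q z y := by
  have key : (G.projOne z).pairWeight (G.weightOne q z) x y =
      (∑ e : {e : G.E // G.tail e ≠ z ∧ G.head e ≠ z},
        if G.tail e.1 = x ∧ G.head e.1 = y then q e.1 else 0) +
      ∑ p : {p : G.E × G.E // (G.head p.1 = z ∧ G.tail p.2 = z) ∧
          (G.tail p.1 ≠ z ∧ G.head p.2 ≠ z)},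
        if G.tail p.1.1 = x ∧ G.head p.1.2 = y then q p.1.1 * q p.1.2 else 0 := by
    rw [pairWeight, Finset.sum_filter]
    exact Fintype.sum_sum_type _
  rw [key]
  congr 1
  · rw [pairWeight, ← Finset.sum_filter]
    refine Finset.sum_bij (fun e _ => e.1) ?_ ?_ ?_ ?_
    · intro e he; simpa using he
    · intro e _ e' _ h; exact Subtype.ext h
    · rintro e he
      obtain ⟨-, rfl, rfl⟩ := mem_filter.1 he
      exact ⟨⟨e, hx, hy⟩, by simp, rfl⟩
    · intro _ _; rfl
  · rw [pairWeight, pairWeight, Finset.sum_mul_sum, ← Finset.sum_product', ← Finset.sum_filter]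
    refine Finset.sum_bij (fun p _ => p.1) ?_ ?_ ?_ ?_
    · rintro ⟨p, ⟨h₁, h₂⟩, h₃⟩ hp
      simp only [mem_filter, mem_univ, true_and] at hp
      simp [h₁, h₂, hp]
    · intro e _ e' _ h; exact Subtype.ext h
    · rintro ⟨e, f⟩ he
      simp only [mem_product, mem_filter, mem_univ, true_and] at he
      obtain ⟨⟨rfl, h1⟩, h2, rfl⟩ := he
      exact ⟨⟨(e, f), ⟨h1, h2⟩, hx, hy⟩, by simp, rfl⟩
    · intro _ _; rfl

theorem SameGraph.pairWeight_eq {L : Type*} {H K : DAMG.{u, v} V} {ε : H.E → List L}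
    {ε' : K.E → List L} {q : H.E → R} {q' : K.E → R} (h : SameGraph H K ε ε' q q') (x y : V) :
    H.pairWeight q x y = K.pairWeight q' x y := by
  obtain ⟨-, φ, hφ⟩ := h
  refine Finset.sum_bij (fun e _ => φ e) ?_ ?_ ?_ ?_
  · intro e he; simpa [hφ e] using he
  · intro e _ e' _ h; exact φ.injective h
  · intro e he
    obtain ⟨e, rfl⟩ := φ.surjective e
    exact ⟨e, by simpa [hφ e] using he, rfl⟩
  · intro e _; exact (hφ e).2.2.2.symm

/-! Functions whose value at a vertex is the weighted sum of the values at its parents. -/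

/-- The value of `f` at every vertex outside of `N` is the weighted sum of its values at the
parents. -/
def IsHarmonicOff (G : DAMG.{u, v} V) (q : G.E → R) (N : Finset V) (f : V → R) : Prop :=
  ∀ y ∈ G.verts, y ∉ N → f y = ∑ x ∈ G.verts, f x * G.pairWeight q x y

theorem sum_attach_pa (G : DAMG.{u, v} V) (q : G.E → R) (f : V → R) (y : V) :
    ∑ z ∈ (G.pa y).attach, f z.1 * G.pairWeight q z.1 y =
      ∑ x ∈ G.verts, f x * G.pairWeight q x y := by
  rw [Finset.sum_attach (G.pa y) fun z => f z * G.pairWeight q z y]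
  refine Finset.sum_subset (fun z hz => ?_) fun z _ hz => ?_
  · obtain ⟨e, rfl, -⟩ := mem_pa.1 hz
    exact G.tail_mem e
  · rw [pairWeight_eq_zero q hz, mul_zero]

theorem isHarmonicOff_one_iff (G : DAMG.{u, v} V) (q : G.E → R) :
    G.IsHarmonicOff q G.roots (fun _ => 1) ↔ G.IsNormalized q := by
  simp only [IsHarmonicOff, IsNormalized, one_mul, eq_comm]

theorem IsHarmonicOff.eqOn {G : DAMG.{u, v} V} {q : G.E → R} {N : Finset V} {f g : V → R}
    (hf : G.IsHarmonicOff q N f) (hg : G.IsHarmonicOff q N g) (hN : ∀ x ∈ G.verts, x ∈ N → f x = g x)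
    (y : V) (hy : y ∈ G.verts) : f y = g y := by
  induction y using G.induction_parents with
  | h y ih =>
    by_cases hyN : y ∈ N
    · exact hN y hy hyN
    rw [hf y hy hyN, hg y hy hyN]
    refine Finset.sum_congr rfl fun x hx => ?_
    by_cases hxy : x ∈ G.pa y
    · obtain ⟨e, rfl, he⟩ := mem_pa.1 hxy
      rw [ih e he (G.tail_mem e)]
    · simp [pairWeight_eq_zero q hxy]

theorem elementWeight_of_mem_roots {G : DAMG.{u, v} V} (ς : G.E → R) (τ : V → R) {y : V}
    (hy : y ∈ G.roots) : G.elementWeight ς τ y = τ y := by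
  rw [elementWeight, if_pos hy]

theorem isHarmonicOff_elementWeight (G : DAMG.{u, v} V) (ς : G.E → R) (τ : V → R) :
    G.IsHarmonicOff ς G.roots (G.elementWeight ς τ) := fun y _ hy => by
  rw [elementWeight, if_neg hy, sum_attach_pa]

theorem totalPathWeight_self {G : DAMG.{u, v} V} (q : G.E → R) {x : V} (hx : x ∈ G.verts) :
    G.totalPathWeight q x x = 1 := by
  rw [totalPathWeight, if_neg (not_not.2 (mem_desc_self hx)), if_pos rfl]

/-- Parents of a non-descendant of `x` are non-descendants, so there both sides vanish; `x` is the
only exceptional vertex. -/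
theorem isHarmonicOff_totalPathWeight (G : DAMG.{u, v} V) (q : G.E → R) (x : V) :
    G.IsHarmonicOff q {x} (G.totalPathWeight q x) := fun y _ hy => by
  by_cases h : y ∈ G.desc x
  · rw [totalPathWeight, if_neg (not_not.2 h), if_neg fun h' => hy (mem_singleton.2 h'),
      sum_attach_pa]
  · rw [totalPathWeight, if_pos h]
    symm
    refine Finset.sum_eq_zero fun z _ => ?_
    by_cases hz : z ∈ G.pa y
    · obtain ⟨e, rfl, rfl⟩ := mem_pa.1 hz
      rw [totalPathWeight, if_pos, zero_mul]
      intro hz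
      obtain ⟨p, hp⟩ := mem_desc.1 hz
      exact h (mem_desc.2 ⟨_, hp.append (p' := [e]) ⟨rfl, G.head_mem e, rfl⟩⟩)
    · rw [pairWeight_eq_zero q hz, mul_zero]

/-- Substitute the equation at `z`, available because `z ∉ N`, into the equation at `y`. -/
theorem IsHarmonicOff.projOne {G : DAMG.{u, v} V} {q : G.E → R} {N : Finset V} {f : V → R}
    (h : G.IsHarmonicOff q N f) {z : V} (hz : z ∈ G.verts) (hzN : z ∉ N) :
    (G.projOne z).IsHarmonicOff (G.weightOne q z) N f := by
  intro y hy hyN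
  obtain ⟨hyz, hy⟩ := mem_erase.1 hy
  have hfz := h z hz hzN
  rw [← Finset.add_sum_erase _ _ hz, pairWeight_self, mul_zero, zero_add] at hfz
  rw [h y hy hyN, ← Finset.add_sum_erase _ _ hz, hfz, Finset.sum_mul, ← Finset.sum_add_distrib]
  refine Finset.sum_congr rfl fun x hx => ?_
  rw [pairWeight_projOne G q (ne_of_mem_erase hx) hyz]
  ring

theorem IsHarmonicOff.projList {G : DAMG.{u, v} V} {q : G.E → R} {N : Finset V} {f : V → R}
    (h : G.IsHarmonicOff q N f) {l : List V} (hl : l.Nodup) (hlG : ∀ z ∈ l, z ∈ G.verts)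
    (hlN : ∀ z ∈ l, z ∉ N) : (G.projList l).IsHarmonicOff (G.weightList q l) N f := by
  induction l generalizing G with
  | nil => exact h
  | cons z l ih =>
    obtain ⟨hzl, hl⟩ := List.nodup_cons.1 hl
    simp only [List.mem_cons, forall_eq_or_imp] at hlG hlN
    exact ih (h.projOne hlG.1 hlN.1) hl
      (fun y hy => mem_erase.2 ⟨fun h => hzl (h ▸ hy), hlG.2 y hy⟩) hlN.2

theorem IsHarmonicOff.proj {G : DAMG.{u, v} V} {q : G.E → R} {N : Finset V} {f : V → R}
    (h : G.IsHarmonicOff q N f) {S : Finset V} (hS : S ⊆ G.verts) (hSN : Disjoint S N) :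
    (G.proj S).IsHarmonicOff (G.projWeight q S) N f :=
  h.projList S.nodup_toList (fun _ hz => hS (mem_toList.1 hz))
    fun _ hz => Finset.disjoint_left.1 hSN (mem_toList.1 hz)

theorem totalPathWeight_proj (G : DAMG.{u, v} V) (q : G.E → R) {S : Finset V} (hS : S ⊆ G.verts)
    {x y : V} (hx : x ∈ G.verts \ S) (hy : y ∈ G.verts \ S) :
    (G.proj S).totalPathWeight (G.projWeight q S) x y = G.totalPathWeight q x y := by
  have hv := (IsProjection.proj G S).verts_eq
  refine (isHarmonicOff_totalPathWeight _ _ x).eqOn ((isHarmonicOff_totalPathWeight G q x).proj hS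
    (disjoint_singleton_right.2 (mem_sdiff.1 hx).2)) (fun _ _ hz => ?_) y (hv ▸ hy)
  rw [mem_singleton.1 hz, totalPathWeight_self _ (hv ▸ hx),
    totalPathWeight_self _ (mem_sdiff.1 hx).1]

/-- No edge enters a root, so removing it creates no composite edge. -/
theorem pairWeight_projList_of_roots (G : DAMG.{u, v} V) (q : G.E → R) {l : List V}
    (hl : l.Nodup) (hlr : ∀ z ∈ l, z ∈ G.roots) {x y : V} (hx : x ∉ l) (hy : y ∉ l) :
    (G.projList l).pairWeight (G.weightList q l) x y = G.pairWeight q x y := by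
  induction l generalizing G with
  | nil => rfl
  | cons z l ih =>
    obtain ⟨hzl, hl⟩ := List.nodup_cons.1 hl
    simp only [List.mem_cons, forall_eq_or_imp, not_or] at hlr hx hy
    refine (ih (G.projOne z) (G.weightOne q z) hl (fun y hy => ?_) hx.2 hy.2).trans ?_
    · exact (IsProjection.projOne G z).roots_subset
        (mem_sdiff.2 ⟨hlr.2 y hy, fun h => hzl (mem_singleton.1 h ▸ hy)⟩)
    · rw [pairWeight_projOne G q hx.1 hy.1, pairWeight_eq_zero_of_mem_roots q hlr.1, zero_mul,
        add_zero]

theorem projWeight_comp (G : DAMG.{u, v} V) (q : G.E → R) (S U : Finset V)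
    (e : ((G.proj S).proj U).E) : (G.proj S).projWeight (G.projWeight q S) U e =
      ((((G.proj S).expand U e).flatMap (G.expand S)).map q).prod := by
  simp only [prod_map_flatMap, ← projWeight_eq]

/-- Remove the non-roots `T` first, which preserves harmonicity, then the roots `U`, which only
deletes edges. By admissibility, a vertex that keeps a parent had none in `U`, so its equation loses
no term. -/
theorem IsHarmonicOff.proj_of_isAdmissible {G : DAMG.{u, v} V} {q : G.E → R} {f : V → R}
    (h : G.IsHarmonicOff q G.roots f) {S : Finset V} (hS : S ⊆ G.verts) (hSa : G.IsAdmissible S) :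
    (G.proj S).IsHarmonicOff (G.projWeight q S) (G.proj S).roots f := by
  rw [IsAdmissible] at hSa
  set T := S \ G.roots with hT
  set U := S ∩ G.roots with hU
  have hTU : T ∪ U = S := sdiff_union_inter S G.roots
  have hTr : T ∩ G.roots = ∅ := by rw [hT]; exact disjoint_iff_inter_eq_empty.1 sdiff_disjoint
  have pS := IsProjection.proj G S
  have pT := IsProjection.proj G T
  have pU := IsProjection.proj (G.proj T) U
  have pTU := pT.comp pU
  rw [hTU] at pTU
  have same := pS.sameGraph pTU (G.projWeight_eq q S) (G.projWeight_comp q T U)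
  have hUr : U ⊆ (G.proj T).roots := fun z hz => by
    rw [← pT.roots_eq hTr]
    obtain ⟨h1, h2⟩ := mem_inter.1 hz
    exact mem_sdiff.2 ⟨h2, fun h => (mem_sdiff.1 h).2 h2⟩
  have hT' : (G.proj T).IsHarmonicOff (G.projWeight q T) G.roots f :=
    h.proj (sdiff_subset.trans hS) sdiff_disjoint
  intro y hy hyr
  have hyS : y ∈ G.verts \ S := pS.verts_eq ▸ hy
  obtain ⟨hyG, hyS'⟩ := mem_sdiff.1 hyS
  have hyT : y ∈ (G.proj T).verts :=
    pT.verts_eq ▸ mem_sdiff.2 ⟨hyG, fun h => hyS' (sdiff_subset h)⟩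
  have hyU : y ∉ U := fun h => hyS' (inter_subset_left h)
  have hyG' : y ∉ G.roots := fun h => hyr (pS.roots_subset (mem_sdiff.2 ⟨h, hyS'⟩))
  -- An edge into `y` in the final graph stands for a path through `U` in `G.proj T`; as `U`
  -- consists of roots, it is a single edge.
  obtain ⟨x, hxU, hxy⟩ : ∃ x ∉ U, x ∈ (G.proj T).pa y := by
    obtain ⟨e, rfl⟩ : ∃ e, (G.proj S).head e = y := by
      by_contra! h'
      exact hyr (mem_roots.2 ⟨hy, h'⟩)
    obtain ⟨-, φ, hφ⟩ := same
    rw [← (hφ e).2.1]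
    exact ⟨_, pU.tail_notMem (φ e), (pU.isThrough (φ e)).of_subset_roots hUr⟩
  have hdis : ∀ z ∈ U, z ∉ (G.proj T).pa y := fun z hz hz' =>
    hxU (hSa y hyT ⟨z, mem_inter.2 ⟨hz', hz⟩⟩ hxy)
  rw [hT' y hyT hyG', same.1, pU.verts_eq]
  refine (Finset.sum_subset sdiff_subset fun z hz hz' => ?_).symm.trans
    (Finset.sum_congr rfl fun z hz => ?_)
  · have : z ∈ U := by
      by_contra hzU
      exact hz' (mem_sdiff.2 ⟨hz, hzU⟩)
    rw [pairWeight_eq_zero _ (hdis z this), mul_zero]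
  · rw [same.pairWeight_eq]
    congr 1
    exact (pairWeight_projList_of_roots (G.proj T) _ U.nodup_toList
      (fun z hz => hUr (mem_toList.1 hz)) (fun h => (mem_sdiff.1 hz).2 (mem_toList.1 h))
      fun h => hyU (mem_toList.1 h)).symm

theorem IsNormalized.proj {G : DAMG.{u, v} V} {q : G.E → R} (h : G.IsNormalized q)
    {S : Finset V} (hS : S ⊆ G.verts) (hSa : G.IsAdmissible S) :
    (G.proj S).IsNormalized (G.projWeight q S) :=
  (isHarmonicOff_one_iff _ _).1
    (((isHarmonicOff_one_iff G q).2 h).proj_of_isAdmissible hS hSa)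

theorem elementWeight_proj (G : DAMG.{u, v} V) (ς : G.E → R) (τ : V → R) {S : Finset V}
    (hS : S ⊆ G.verts) (hSa : G.IsAdmissible S) {x : V} (hx : x ∈ G.verts \ S) :
    (G.proj S).elementWeight (G.projWeight ς S) (G.elementWeight ς τ) x =
      G.elementWeight ς τ x :=
  (isHarmonicOff_elementWeight _ _ _).eqOn
    ((isHarmonicOff_elementWeight G ς τ).proj_of_isAdmissible hS hSa)
    (fun _ _ hz => elementWeight_of_mem_roots _ _ hz) x
    ((IsProjection.proj G S).verts_eq ▸ hx)

end

/-! ### Synergy functions and the linear system for their projection -/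

section

variable {A : Type*} [AddCommGroup A]

theorem synergy_eq (G : DAMG.{u, v} V) (f : V → A) (x : V) :
    G.synergy f x = f x - ∑ y ∈ (G.anc x).erase x, G.synergy f y := by
  rw [synergy, Finset.sum_attach ((G.anc x).erase x) fun y => G.synergy f y]

/-- The synergy function is determined by the values at the vertices. -/
theorem synergy_unique {G : DAMG.{u, v} V} {f g : V → A}
    (h : ∀ x ∈ G.verts, f x = ∑ y ∈ G.anc x, g y) (x : V) (hx : x ∈ G.verts) :
    G.synergy f x = g x := by
  induction hn : (G.anc x).card using Nat.strong_induction_on generalizing x with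
  | _ n ih =>
    subst hn
    rw [synergy_eq, h x hx, ← Finset.add_sum_erase _ _ (mem_anc_self hx), sub_eq_iff_eq_add]
    congr 1
    refine Finset.sum_congr rfl fun y hy => ?_
    obtain ⟨hyx, hy⟩ := mem_erase.1 hy
    exact (ih _ (G.card_anc_lt hy hyx) y (G.anc_subset_verts x hy) rfl).symm

theorem sum_anc_synergy {G : DAMG.{u, v} V} (f : V → A) {x : V} (hx : x ∈ G.verts) :
    ∑ y ∈ G.anc x, G.synergy f y = f x := by
  rw [← Finset.add_sum_erase _ _ (mem_anc_self hx), synergy_eq, sub_add_cancel]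

end

section

variable {R : Type*} [CommRing R] {A : Type*} [AddCommGroup A] [Module R A]

theorem synergy_linear (G : DAMG.{u, v} V) (f g : V → A) (r s : R) {x : V} (hx : x ∈ G.verts) :
    G.synergy (fun y => r • f y + s • g y) x = r • G.synergy f x + s • G.synergy g x :=
  synergy_unique (g := fun x => r • G.synergy f x + s • G.synergy g x)
    (fun y hy => by
      rw [Finset.sum_add_distrib, ← Finset.smul_sum, ← Finset.smul_sum, sum_anc_synergy f hy,
        sum_anc_synergy g hy]) x hx

theorem synergy_sum_smul (G : DAMG.{u, v} V) {n : ℕ} (f : Fin n → V → R) (a : Fin n → A) {x : V}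
    (hx : x ∈ G.verts) :
    G.synergy (fun y => ∑ i, f i y • a i) x = ∑ i, G.synergy (f i) x • a i :=
  synergy_unique (g := fun x => ∑ i, G.synergy (f i) x • a i)
    (fun y hy => by
      rw [Finset.sum_comm]
      refine Finset.sum_congr rfl fun i _ => ?_
      rw [← Finset.sum_smul, sum_anc_synergy _ hy]) x hx

/-! The projection of the synergy function, obtained by solving a triangular linear system. -/

/-- `W` extends the projection of `w` along `X` to all vertices: it solves the linear system
`W x = w x + ∑ y ∈ X, q(x|y) W y`. -/
def IsSolution (G : DAMG.{u, v} V) (q : G.E → R) (w : V → A) (X : Finset V) (W : V → A) : Prop :=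
  ∀ x ∈ G.verts, W x = w x + ∑ y ∈ X, G.pairWeight q x y • W y

namespace IsSolution

variable {G : DAMG.{u, v} V} {q : G.E → R} {w : V → A} {X : Finset V} {W : V → A}

/-- One step of Gaussian elimination: the equation at `z` expresses `W z` by the other unknowns,
since `q(z|z) = 0`; substituting it gives the system of the projected data with the same `W`. -/
theorem projOne (h : G.IsSolution q w X W) (hX : X ⊆ G.verts) {z : V} (hz : z ∈ X) :
    (G.projOne z).IsSolution (G.weightOne q z) (G.synergyOne q w z) (X.erase z) W := by
  intro x hx
  obtain ⟨hxz, hx⟩ := mem_erase.1 hx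
  have hWz := h z (hX hz)
  rw [← Finset.add_sum_erase _ _ hz, pairWeight_self, zero_smul, zero_add] at hWz
  have hsum : ∑ y ∈ X.erase z, (G.projOne z).pairWeight (G.weightOne q z) x y • W y =
      ∑ y ∈ X.erase z, G.pairWeight q x y • W y +
        G.pairWeight q x z • ∑ y ∈ X.erase z, G.pairWeight q z y • W y := by
    rw [Finset.smul_sum, ← Finset.sum_add_distrib]
    refine Finset.sum_congr rfl fun y hy => ?_
    rw [pairWeight_projOne G q hxz (ne_of_mem_erase hy), add_smul, mul_smul]
  rw [hsum, h x hx, ← Finset.add_sum_erase _ _ hz, synergyOne]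
  nth_rw 1 [hWz]
  rw [smul_add]
  abel

theorem projList (h : G.IsSolution q w X W) (hX : X ⊆ G.verts) {l : List V} (hl : l.Nodup)
    (hlX : ∀ z ∈ l, z ∈ X) :
    (G.projList l).IsSolution (G.weightList q l) (G.synergyList q w l) (X \ l.toFinset) W := by
  induction l generalizing G w X with
  | nil =>
    rw [List.toFinset_nil, sdiff_empty]
    exact h
  | cons z l ih =>
    obtain ⟨hzl, hl⟩ := List.nodup_cons.1 hl
    simp only [List.mem_cons, forall_eq_or_imp] at hlX
    have := ih (h.projOne hX hlX.1) (erase_subset_erase z hX) hl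
      fun y hy => mem_erase.2 ⟨fun h => hzl (h ▸ hy), hlX.2 y hy⟩
    have hXl : X \ (z :: l).toFinset = X.erase z \ l.toFinset := by
      ext y; simp; tauto
    rw [hXl]
    exact this

theorem proj (h : G.IsSolution q w X W) (hX : X ⊆ G.verts) {S : Finset V} (hS : S ⊆ X) :
    (G.proj S).IsSolution (G.projWeight q S) (G.projSynergy q w S) (X \ S) W := by
  have := h.projList hX S.nodup_toList fun z hz => hS (mem_toList.1 hz)
  rwa [toList_toFinset] at this

/-- Once all of `X` is eliminated, the sum in the system is empty and the system itself reads `W =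
w`. -/
theorem synergyList_eq {l : List V} (h : G.IsSolution q w l.toFinset W)
    (hX : l.toFinset ⊆ G.verts) (hl : l.Nodup) {x : V} (hx : x ∈ G.verts \ l.toFinset) :
    G.synergyList q w l x = W x := by
  have := h.projList hX hl (fun z hz => List.mem_toFinset.2 hz) x
    ((IsProjection.projList G l).verts_eq ▸ hx)
  rw [this]
  simp

theorem projSynergy_eq (h : G.IsSolution q w X W) (hX : X ⊆ G.verts) {x : V}
    (hx : x ∈ G.verts \ X) : G.projSynergy q w X x = W x := by
  rw [← toList_toFinset X] at h hX hx
  exact h.synergyList_eq hX X.nodup_toList hx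

theorem congr {w' : V → A} (h : G.IsSolution q w X W) (hw : ∀ x ∈ G.verts, w' x = w x) :
    G.IsSolution q w' X W := fun x hx => by rw [hw x hx, h x hx]

theorem _root_.DAMG.exists_isSolution (G : DAMG.{u, v} V) (q : G.E → R) (w : V → A)
    (X : Finset V) : ∃ W, G.IsSolution q w X W := by
  suffices H : ∀ l : List V, l.Nodup → ∃ W, G.IsSolution q w l.toFinset W by
    simpa using H X.toList X.nodup_toList
  intro l hl
  induction l generalizing G w with
  | nil => exact ⟨w, fun x _ => by simp⟩
  | cons z l ih =>
    obtain ⟨hzl, hl⟩ := List.nodup_cons.1 hl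
    obtain ⟨W, hW⟩ := ih (G.projOne z) (G.weightOne q z) (G.synergyOne q w z) hl
    -- Back substitution: with the unknowns of `l` solved after eliminating `z`, the value at `z` is
    -- dictated by its own equation.
    set Wz : A := w z + ∑ y ∈ l.toFinset, G.pairWeight q z y • W y with hWz
    have hne : ∀ y ∈ l.toFinset, y ≠ z := fun y hy h => hzl (h ▸ List.mem_toFinset.1 hy)
    have hsum : ∀ x, ∑ y ∈ (z :: l).toFinset, G.pairWeight q x y • Function.update W z Wz y =
        G.pairWeight q x z • Wz + ∑ y ∈ l.toFinset, G.pairWeight q x y • W y := fun x => by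
      rw [List.toFinset_cons, Finset.sum_insert (by simpa using hzl), Function.update_self]
      congr 1
      refine Finset.sum_congr rfl fun y hy => ?_
      rw [Function.update_of_ne (hne y hy)]
    refine ⟨Function.update W z Wz, fun x hx => ?_⟩
    rw [hsum]
    by_cases hxz : x = z
    · subst hxz
      rw [Function.update_self, pairWeight_self, zero_smul, zero_add]
    · rw [Function.update_of_ne hxz, hW x (mem_erase.2 ⟨hxz, hx⟩), synergyOne, hWz, smul_add,
        Finset.smul_sum, add_assoc, add_assoc]
      congr 2
      rw [← Finset.sum_add_distrib]
      refine Finset.sum_congr rfl fun y hy => ?_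
      rw [pairWeight_projOne G q hxz (hne y hy), add_smul, mul_smul, add_comm]

/-- A solution vanishes on a set on which `w` vanishes, if all children in `X` of the elements of
this set belong to it. -/
theorem eq_zero (h : G.IsSolution q w X W) {D : Finset V} (hD : D ⊆ G.verts)
    (hw : ∀ x ∈ D, w x = 0) (hcl : ∀ e, G.tail e ∈ D → G.head e ∈ X → G.head e ∈ D)
    (x : V) (hx : x ∈ D) : W x = 0 := by
  induction x using G.induction_children with
  | h x ih =>
    rw [h x (hD hx), hw x hx, zero_add]
    refine Finset.sum_eq_zero fun y hy => ?_
    by_cases hxy : x ∈ G.pa y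
    · obtain ⟨e, rfl, rfl⟩ := mem_pa.1 hxy
      rw [ih e rfl (hcl e hx hy), smul_zero]
    · rw [pairWeight_eq_zero q hxy, zero_smul]

theorem eq_zero_of_isNull {f : V → A} (h : G.IsSolution q (G.synergy f) X W) {y : V}
    (hy : G.IsNull f y) {x : V} (hx : x ∈ G.desc y) : W x = 0 := by
  refine h.eq_zero (D := G.desc y) (fun z hz => ?_) hy.2 (fun e he _ => ?_) x hx
  · obtain ⟨p, hp⟩ := mem_desc.1 hz
    exact hp.right_mem
  · obtain ⟨p, hp⟩ := mem_desc.1 he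
    exact mem_desc.2 ⟨_, hp.append (p' := [e]) ⟨rfl, G.head_mem e, rfl⟩⟩

/-- Sum the system over all vertices. Each `W y` with `y ∈ X` gets the total incoming weight of `y`
as coefficient, which is 1 unless `y` is a root, where `W y = 0`; then `∑ y ∈ X, W y` cancels. -/
theorem sum_sdiff_eq (h : G.IsSolution q w X W) (hX : X ⊆ G.verts) (hq : G.IsNormalized q)
    (hr : ∀ y ∈ X, y ∈ G.roots → W y = 0) :
    ∑ x ∈ G.verts \ X, W x = ∑ x ∈ G.verts, w x := by
  have h1 : ∑ x ∈ G.verts, W x = ∑ x ∈ G.verts, w x + ∑ y ∈ X, W y := by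
    rw [Finset.sum_congr rfl h, Finset.sum_add_distrib, Finset.sum_comm]
    congr 1
    refine Finset.sum_congr rfl fun y hy => ?_
    rw [← Finset.sum_smul]
    by_cases hyr : y ∈ G.roots
    · rw [hr y hy hyr, smul_zero]
    · rw [hq y (hX hy) hyr, one_smul]
  rw [← Finset.sum_sdiff hX] at h1
  exact add_right_cancel h1

end IsSolution

/-! ### Properties of projected synergy and value functions -/

section

variable (G : DAMG.{u, v} V) (q : G.E → R) {S : Finset V}

theorem synergyList_eq_projSynergy (w : V → A) (hS : S ⊆ G.verts) {l : List V} (hl : l.Nodup)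
    (hlS : l.toFinset = S) {x : V} (hx : x ∈ G.verts \ S) :
    G.synergyList q w l x = G.projSynergy q w S x := by
  obtain ⟨W, hW⟩ := G.exists_isSolution q w S
  subst hlS
  rw [hW.synergyList_eq hS hl hx, hW.projSynergy_eq hS hx]

/-- The projected value function is defined as an ancestor sum, and Möbius inversion is unique. -/
theorem synergy_projValue (f : V → A) {x : V} (hx : x ∈ G.verts \ S) :
    (G.proj S).synergy (G.projValue q f S) x = G.projSynergy q (G.synergy f) S x :=
  synergy_unique (fun _ _ => rfl) x ((IsProjection.proj G S).verts_eq ▸ hx)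

theorem projSynergy_linear (hS : S ⊆ G.verts) (f g : V → A) (r s : R) {x : V}
    (hx : x ∈ G.verts \ S) :
    G.projSynergy q (G.synergy fun y => r • f y + s • g y) S x =
      r • G.projSynergy q (G.synergy f) S x + s • G.projSynergy q (G.synergy g) S x := by
  obtain ⟨W, hW⟩ := G.exists_isSolution q (G.synergy f) S
  obtain ⟨W', hW'⟩ := G.exists_isSolution q (G.synergy g) S
  have : G.IsSolution q (G.synergy fun y => r • f y + s • g y) S fun x => r • W x + s • W' x := by
    intro y hy
    simp only [smul_add, Finset.sum_add_distrib]
    rw [synergy_linear G f g r s hy, hW y hy, hW' y hy, smul_add, smul_add, Finset.smul_sum,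
      Finset.smul_sum]
    simp only [smul_comm _ r, smul_comm _ s]
    abel
  rw [hW.projSynergy_eq hS hx, hW'.projSynergy_eq hS hx, this.projSynergy_eq hS hx]

theorem projSynergy_sum_smul (hS : S ⊆ G.verts) {n : ℕ} (f : Fin n → V → R) (a : Fin n → A) {x : V}
    (hx : x ∈ G.verts \ S) :
    G.projSynergy q (G.synergy fun y => ∑ i, f i y • a i) S x =
      ∑ i, G.projSynergy q (G.synergy (f i)) S x • a i := by
  choose W hW using fun i => G.exists_isSolution q (G.synergy (f i)) S
  have : G.IsSolution q (G.synergy fun y => ∑ i, f i y • a i) S fun x => ∑ i, W i x • a i := by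
    intro y hy
    rw [synergy_sum_smul G f a hy]
    simp only [Finset.smul_sum]
    rw [Finset.sum_comm, ← Finset.sum_add_distrib]
    refine Finset.sum_congr rfl fun i _ => ?_
    rw [hW i y hy, add_smul, Finset.sum_smul]
    simp only [smul_assoc]
  rw [this.projSynergy_eq hS hx]
  exact Finset.sum_congr rfl fun i _ => by rw [(hW i).projSynergy_eq hS hx]

/-- A relation between projected value functions holds if and only if it holds between their
synergy functions. -/
theorem projValue_eq_iff {f g : V → A} {w : V → A}
    (hw : ∀ y ∈ (G.proj S).verts, g y = ∑ x ∈ (G.proj S).anc y, w x) :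
    (∀ x ∈ G.verts \ S, G.projValue q f S x = g x) ↔
      ∀ x ∈ G.verts \ S, G.projSynergy q (G.synergy f) S x = w x := by
  rw [← (IsProjection.proj G S).verts_eq]
  constructor
  · intro h x hx
    rw [← synergy_projValue G q f ((IsProjection.proj G S).verts_eq ▸ hx)]
    exact synergy_unique (fun y hy => (h y hy).trans (hw y hy)) x hx
  · intro h x hx
    rw [hw x hx, projValue]
    exact Finset.sum_congr rfl fun y hy => h y (anc_subset_verts _ x hy)

theorem IsNull.proj {f : V → A} (hS : S ⊆ G.verts) {y : V} (hy : y ∈ G.verts \ S)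
    (h : G.IsNull f y) : (G.proj S).IsNull (G.projValue q f S) y := by
  have hp := IsProjection.proj G S
  refine ⟨hp.verts_eq ▸ hy, fun x hx => ?_⟩
  have hx' : x ∈ G.verts \ S := by
    obtain ⟨p, hp'⟩ := mem_desc.1 hx
    exact hp.verts_eq ▸ hp'.right_mem
  obtain ⟨W, hW⟩ := G.exists_isSolution q (G.synergy f) S
  rw [synergy_projValue G q f hx', hW.projSynergy_eq hS hx']
  exact hW.eq_zero_of_isNull h (hp.desc_subset y hx)

theorem IsWeak.proj {f : V → A} (hS : S ⊆ G.verts) {U : Finset V} (hSU : Disjoint S U)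
    (h : ∀ z ∈ S ∪ U, G.IsWeak f z) {z : V} (hz : z ∈ U) :
    (G.proj S).IsWeak (G.projValue q f S) z := by
  have hz' : z ∈ G.verts \ S := mem_sdiff.2
    ⟨(h z (mem_union_right _ hz)).1, fun hzS => Finset.disjoint_left.1 hSU hzS hz⟩
  refine ⟨(IsProjection.proj G S).verts_eq ▸ hz', ?_⟩
  obtain ⟨W, hW⟩ := G.exists_isSolution q (G.synergy f) S
  rw [synergy_projValue G q f hz', hW.projSynergy_eq hS hz']
  -- Apply vanishing to the set `S ∪ U`: the system only involves children in `S`, which lie in it.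
  exact hW.eq_zero (fun x hx => (h x hx).1) (fun x hx => (h x hx).2)
    (fun e _ he => mem_union_left _ he) z (mem_union_right _ hz)

theorem sum_projSynergy {f : V → A} (hS : S ⊆ G.verts) (hq : G.IsNormalized q)
    (h : ∀ z ∈ S ∩ G.roots, G.IsNull f z) :
    ∑ x ∈ (G.proj S).verts, G.projSynergy q (G.synergy f) S x =
      ∑ x ∈ G.verts, G.synergy f x := by
  obtain ⟨W, hW⟩ := G.exists_isSolution q (G.synergy f) S
  rw [(IsProjection.proj G S).verts_eq, Finset.sum_congr rfl fun x hx => hW.projSynergy_eq hS hx]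
  exact hW.sum_sdiff_eq hS hq fun y hy hyr =>
    hW.eq_zero_of_isNull (h y (mem_inter.2 ⟨hy, hyr⟩)) (mem_desc_self (hS hy))

variable {U : Finset V}

/-- A single solution for `S ∪ U` computes the projection in either order. The function `w'` need
only agree with the projected synergy on the remaining vertices, so it may also be the synergy of
the projected value function. -/
theorem IsSolution.projSynergy_projSynergy {G : DAMG.{u, v} V} {q : G.E → R} {w w' W : V → A}
    (h : G.IsSolution q w (S ∪ U) W) (hS : S ⊆ G.verts) (hU : U ⊆ G.verts) (hSU : Disjoint S U)
    (hw' : ∀ x ∈ G.verts \ S, w' x = G.projSynergy q w S x) {x : V}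
    (hx : x ∈ G.verts \ (S ∪ U)) :
    (G.proj S).projSynergy (G.projWeight q S) w' U x = W x := by
  have hv := (IsProjection.proj G S).verts_eq
  have h' := (h.proj (union_subset hS hU) subset_union_left).congr (w' := w') (hv ▸ hw')
  rw [Finset.union_sdiff_cancel_left hSU] at h'
  refine h'.projSynergy_eq (fun z hz => hv ▸ mem_sdiff.2 ⟨hU hz, fun hzS =>
    Finset.disjoint_left.1 hSU hzS hz⟩) ?_
  rw [hv, sdiff_sdiff_left]
  exact hx

theorem projSynergy_comm {w wS wU : V → A} (hS : S ⊆ G.verts) (hU : U ⊆ G.verts)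
    (hSU : Disjoint S U) (hwS : ∀ x ∈ G.verts \ S, wS x = G.projSynergy q w S x)
    (hwU : ∀ x ∈ G.verts \ U, wU x = G.projSynergy q w U x) {x : V}
    (hx : x ∈ G.verts \ (S ∪ U)) :
    (G.proj S).projSynergy (G.projWeight q S) wS U x =
      (G.proj U).projSynergy (G.projWeight q U) wU S x := by
  obtain ⟨W, hW⟩ := G.exists_isSolution q w (S ∪ U)
  rw [hW.projSynergy_projSynergy hS hU hSU hwS hx]
  rw [union_comm] at hW hx
  rw [hW.projSynergy_projSynergy hU hS hSU.symm hwU hx]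

theorem projValue_comm (f : V → A) (hS : S ⊆ G.verts) (hU : U ⊆ G.verts)
    (hSU : Disjoint S U) {x : V} (hx : x ∈ G.verts \ (S ∪ U)) :
    (G.proj S).projValue (G.projWeight q S) (G.projValue q f S) U x =
      (G.proj U).projValue (G.projWeight q U) (G.projValue q f U) S x := by
  have p₁ := (IsProjection.proj G S).comp (IsProjection.proj _ U)
  have p₂ := (IsProjection.proj G U).comp (IsProjection.proj _ S)
  rw [union_comm] at p₂
  have hx' := (mem_sdiff.1 hx).2
  rw [projValue, projValue, p₁.anc_eq hx', p₂.anc_eq hx']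
  refine Finset.sum_congr rfl fun y hy => ?_
  obtain ⟨hy, hy'⟩ := mem_sdiff.1 hy
  exact projSynergy_comm G q hS hU hSU (fun z hz => synergy_projValue G q f hz)
    (fun z hz => synergy_projValue G q f hz) (mem_sdiff.2 ⟨G.anc_subset_verts x hy, hy'⟩)

end

end

end DAMG

/-! ### The main theorem -/

theorem mainTheorem2 {V : Type*} [DecidableEq V] {R : Type*} [CommRing R]
    {A : Type*} [AddCommGroup A] [Module R A]
    (G : DAMG V) (q : G.E → R) (v : V → A) (S : Finset V) (hS : S ⊆ G.verts) :
    -- the projections do not depend on the order in which the elements of `S` are projected out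
    (∀ l : List V, l.Nodup → l.toFinset = S →
      DAMG.SameGraph (G.projList l) (G.proj S) (G.expandList l) (G.expand S)
        (G.weightList q l) (G.projWeight q S) ∧
      ∀ w : V → A, ∀ x ∈ G.verts \ S, G.synergyList q w l x = G.projSynergy q w S x) ∧
    -- DAMG
    ((G.proj S).verts = G.verts \ S ∧
      ∃ r, IsTopologicalOrder (G.proj S).verts (G.proj S).tail (G.proj S).head r) ∧
    -- Roots
    (G.roots \ S ⊆ (G.proj S).roots ∧
      (S ∩ G.roots = ∅ → G.roots \ S = (G.proj S).roots)) ∧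
    -- Ancestors
    (∀ y ∈ G.verts \ S, (G.proj S).anc y = G.anc y \ S) ∧
    -- Directed paths
    (∀ x ∈ G.verts \ S, ∀ y ∈ G.verts \ S,
      Set.BijOn (fun p => p.flatMap (G.expand S)) ((G.proj S).paths x y) (G.paths x y) ∧
      (G.proj S).pathCount x y = G.pathCount x y) ∧
    -- Normalized weights
    (G.IsNormalized q → G.IsAdmissible S → (G.proj S).IsNormalized (G.projWeight q S)) ∧
    -- Total path weights
    (∀ x ∈ G.verts \ S, ∀ y ∈ G.verts \ S,
      (G.proj S).totalPathWeight (G.projWeight q S) x y = G.totalPathWeight q x y) ∧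
    -- Synergy
    (∀ x ∈ G.verts \ S,
      (G.proj S).synergy (G.projValue q v S) x = G.projSynergy q (G.synergy v) S x) ∧
    -- `R`-linearity in the value function, and in the projected value function
    (∀ (v₁ v₂ : V → A) (r₁ r₂ : R),
      (∀ x ∈ G.verts \ S,
        G.projSynergy q (G.synergy (fun y => r₁ • v₁ y + r₂ • v₂ y)) S x =
          r₁ • G.projSynergy q (G.synergy v₁) S x + r₂ • G.projSynergy q (G.synergy v₂) S x) ∧
      ((∀ x ∈ G.verts \ S, G.projValue q v S x =
          r₁ • G.projValue q v₁ S x + r₂ • G.projValue q v₂ S x) ↔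
        ∀ x ∈ G.verts \ S, G.projSynergy q (G.synergy v) S x =
          r₁ • G.projSynergy q (G.synergy v₁) S x + r₂ • G.projSynergy q (G.synergy v₂) S x)) ∧
    -- `A`-linearity in the value function, and in the projected value function
    (∀ (n : ℕ) (f : Fin n → V → R) (a : Fin n → A),
      (∀ x ∈ G.verts \ S,
        G.projSynergy q (G.synergy (fun y => ∑ i, f i y • a i)) S x =
          ∑ i, G.projSynergy q (G.synergy (f i)) S x • a i) ∧
      ((∀ x ∈ G.verts \ S, G.projValue q v S x = ∑ i, G.projValue q (f i) S x • a i) ↔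
        ∀ x ∈ G.verts \ S, G.projSynergy q (G.synergy v) S x =
          ∑ i, G.projSynergy q (G.synergy (f i)) S x • a i)) ∧
    -- Null elements
    (∀ y ∈ G.verts \ S, G.IsNull v y → (G.proj S).IsNull (G.projValue q v S) y) ∧
    -- Efficiency
    (G.IsNormalized q → (S ∩ G.roots = ∅ ∨ ∀ z ∈ S ∩ G.roots, G.IsNull v z) →
      ∑ x ∈ (G.proj S).verts, G.projSynergy q (G.synergy v) S x =
        ∑ x ∈ G.verts, G.synergy v x) ∧
    -- Commutativity
    (∀ U ⊆ G.verts, Disjoint S U →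
      DAMG.SameGraph ((G.proj S).proj U) ((G.proj U).proj S)
        (fun e => ((G.proj S).expand U e).flatMap (G.expand S))
        (fun e => ((G.proj U).expand S e).flatMap (G.expand U))
        ((G.proj S).projWeight (G.projWeight q S) U)
        ((G.proj U).projWeight (G.projWeight q U) S) ∧
      (∀ x ∈ G.verts \ (S ∪ U),
        (G.proj S).projSynergy (G.projWeight q S) (G.projSynergy q (G.synergy v) S) U x =
          (G.proj U).projSynergy (G.projWeight q U) (G.projSynergy q (G.synergy v) U) S x) ∧
      ∀ x ∈ G.verts \ (S ∪ U),
        (G.proj S).projValue (G.projWeight q S) (G.projValue q v S) U x =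
          (G.proj U).projValue (G.projWeight q U) (G.projValue q v U) S x) ∧
    -- Weak elements
    (∀ U ⊆ G.verts, Disjoint S U → (∀ z ∈ S ∪ U, G.IsWeak v z) →
      ∀ z ∈ U, (G.proj S).IsWeak (G.projValue q v S) z) ∧
    -- Element weights
    (∀ (ς : G.E → R) (τ : V → R), G.IsAdmissible S →
      ∀ x ∈ G.verts \ S,
        (G.proj S).elementWeight (G.projWeight ς S) (G.elementWeight ς τ) x =
          G.elementWeight ς τ x) := by
  have hp := DAMG.IsProjection.proj G S
  refine ⟨fun l hl hlS => ⟨?_, fun w x hx => ?_⟩, ⟨hp.verts_eq, (G.proj S).exists_order⟩,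
    ⟨hp.roots_subset, hp.roots_eq⟩, fun y hy => hp.anc_eq (mem_sdiff.1 hy).2,
    fun x hx y hy => ⟨hp.bijOn_paths (mem_sdiff.1 hx).2 (mem_sdiff.1 hy).2,
      hp.pathCount_eq (mem_sdiff.1 hx).2 (mem_sdiff.1 hy).2⟩,
    fun hq hSa => hq.proj hS hSa, fun x hx y hy => G.totalPathWeight_proj q hS hx hy,
    fun x hx => G.synergy_projValue q v hx,
    fun v₁ v₂ r₁ r₂ => ⟨fun x hx => G.projSynergy_linear q hS v₁ v₂ r₁ r₂ hx,
      G.projValue_eq_iff q fun y _ => ?_⟩,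
    fun n f a => ⟨fun x hx => G.projSynergy_sum_smul q hS f a hx,
      G.projValue_eq_iff q fun y _ => ?_⟩,
    fun y hy hnull => hnull.proj G q hS hy,
    fun hq h => G.sum_projSynergy q hS hq ?_,
    fun U hU hSU => ⟨?_, fun x hx => G.projSynergy_comm q hS hU hSU (fun _ _ => rfl)
      (fun _ _ => rfl) hx, fun x hx => G.projValue_comm q v hS hU hSU hx⟩,
    fun U _ hSU hweak z hz => DAMG.IsWeak.proj G q hS hSU hweak hz,
    fun ς τ hSa x hx => G.elementWeight_proj ς τ hS hSa hx⟩
  · exact (hlS ▸ DAMG.IsProjection.projList G l).sameGraph hp (G.weightList_eq q l)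
      (G.projWeight_eq q S)
  · exact G.synergyList_eq_projSynergy q w hS hl hlS hx
  · simp only [DAMG.projValue, Finset.sum_add_distrib, Finset.smul_sum]
  · simp only [DAMG.projValue, Finset.sum_smul]
    exact Finset.sum_comm
  · rcases h with h | h
    · simp [h]
    · exact h
  · have p₁ := hp.comp (DAMG.IsProjection.proj _ U)
    have p₂ := (DAMG.IsProjection.proj G U).comp (DAMG.IsProjection.proj _ S)
    rw [union_comm] at p₂
    exact p₁.sameGraph p₂ (G.projWeight_comp q S U) (G.projWeight_comp q U S)
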